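/- Let $p$ be a prime, $p^*=p$ if $p>2$ and $p^*=4$ if $p=2$. Let $q\in\mathbb C_p$ with $q\ne1$ and $|1-q|_p<p^{-1/(p-1)}$. Write $\exp$ for the $p$-adic exponential series, $\log_p$ for the $p$-adic logarithm, $u^x=\exp(x\log_p u)$, and $[x]_q=\frac{1-q^x}{1-q}$. The $q$-Bernoulli numbers are defined by $\beta_{0,q}=\frac{q-1}{\log_p q}$ and $\sum_{i=0}^n\binom ni q^i\beta_{i,q}-\beta_{n,q}=\delta_{n,1}$ for $n\ge1$. Let $w$ be the Teichmüller character, and put $\langle a+p^*t\rangle=w(a)^{-1}[a+p^*t]_q$ for integers $a$ prime to $p$ and $t\in\mathbb C_p$ with $|t|_p\le1$. Let $\chi\ne1$ be a primitive Dirichlet character with conductor $f$ and values in $\mathbb C_p$, let $F$ be a positive common multiple of $p^*$ and $f$, and for $s\neq1$ in $\mathbb C_p$ with $|s-1|_p\le1$ let $$L_{p,q}(s,t|\chi)=\frac1{s-1}\,\frac1{[F]_q}\sum_{\substack{1\le a\le F\\(a,p)=1}}\chi(a)\,\langle a+p^*t\rangle^{1-s}\sum_{m=0}^\infty\binom{1-s}m\beta_{m,q^F}\,q^{(a+p^*t)m}\left[\frac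 F{a+p^*t}\right]_{q^{a+p^*t}}^m .$$ Then, for every $t\in\mathbb C_p$ with $|t|_p\le1$, the series in this definition converge for all $s\in\mathbb C_p$ with $|s-1|_p\le1$, the limit $L_{p,q}(1,t|\chi):=\lim_{s\to1}L_{p,q}(s,t|\chi)$ exists, and $$L_{p,q}(1,t|\chi)=\frac1{[F]_q}\sum_{\substack{1\le a\le F\\(a,p)=1}}\chi(a)\left\{-\beta_{0,q^F}\log_p\langle a+p^*t\rangle+\sum_{m=1}^\infty\frac{(-1)^m}m\,\beta_{m,q^F}\,q^{(a+p^*t)m}\left(\frac{[F]_q}{[a+p^*t]_q}\right)^m\right\},$$ where the series on the right converge. -/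

import Mathlib

open Filter Topology

noncomputable section

namespace KimPadicL

variable {p : ℕ} [Fact p.Prime]

/-- `p^* = p` for odd `p`, and `2^* = 4`. -/
def pStar (p : ℕ) : ℕ := if p = 2 then 4 else p

/-- The `p`-adic logarithm `log_p x = ∑_{n ≥ 1} (-1)^{n-1} (x - 1)^n / n`, for `‖x - 1‖ < 1`.
Only arguments in this disc occur below. -/
def plog (x : ℂ_[p]) : ℂ_[p] :=
  ∑' n : ℕ, (-1) ^ n * (x - 1) ^ (n + 1) / ((n + 1 : ℕ) : ℂ_[p])

/-- `u ^ x = exp (x log u)`, for a base `u` close to `1` and a `p`-adic exponent `x`. -/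
def ppow (u x : ℂ_[p]) : ℂ_[p] := NormedSpace.exp (x * plog u)

/-- The `q`-number `[x]_q = (1 - q^x) / (1 - q)`. -/
def qNum (q x : ℂ_[p]) : ℂ_[p] := (1 - ppow q x) / (1 - q)

/-- The `q`-Bernoulli numbers, given by `β_{0,q} = (q - 1) / log q` and, for `n ≥ 1`,
`∑_{i ≤ n} (n choose i) q^i β_{i,q} - β_{n,q} = δ_{n,1}`, solved for `β_{n,q}`. -/
def qBernoulli (q : ℂ_[p]) : ℕ → ℂ_[p]
  | 0 => (q - 1) / plog q
  | n + 1 =>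
    ((if n + 1 = 1 then 1 else 0)
      - ∑ i : Fin (n + 1), ((n + 1).choose i : ℂ_[p]) * q ^ (i : ℕ) * qBernoulli q i)
      / (q ^ (n + 1) - 1)

/-- The values of the Teichmüller character (of conductor `p^*`) at natural numbers: for odd `p`,
`w(a) = lim a^(p^n)`; for `p = 2`, `w(a) = ±1` is congruent to `a` modulo `4` (for `a` odd). -/
def teich (p : ℕ) [Fact p.Prime] (a : ℕ) : ℂ_[p] :=
  if p = 2 then ((ZMod.χ₄ (a : ZMod 4) : ℤ) : ℂ_[p])
  else limUnder atTop (fun n : ℕ => (a : ℂ_[p]) ^ p ^ n)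

/-- The point `a + p^* t`. -/
def pt (a : ℕ) (t : ℂ_[p]) : ℂ_[p] := (a : ℂ_[p]) + (pStar p : ℂ_[p]) * t

/-- `⟨a + p^* t⟩ = w(a)⁻¹ [a + p^* t]_q`. -/
def angle (q : ℂ_[p]) (a : ℕ) (t : ℂ_[p]) : ℂ_[p] := (teich p a)⁻¹ * qNum q (pt a t)

/-- The integers `1 ≤ a ≤ F` with `(a, p) = 1`. -/
def units (p F : ℕ) : Finset ℕ := (Finset.Icc 1 F).filter (fun a => Nat.Coprime a p)

/-- The `m`-th term of the series in the definition of the two-variable `p`-adic `q`-`L`-function: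
`(1-s choose m) β_{m,q^F} q^{(a + p^* t) m} ([F / (a + p^* t)]_{q^{a + p^* t}})^m`. -/
def LTerm (q : ℂ_[p]) (F a : ℕ) (s t : ℂ_[p]) (m : ℕ) : ℂ_[p] :=
  Ring.choose (1 - s) m * qBernoulli (q ^ F) m * ppow q (pt a t * (m : ℂ_[p]))
    * qNum (ppow q (pt a t)) ((F : ℂ_[p]) / pt a t) ^ m

/-- The formula that defines the two-variable `p`-adic `q`-`L`-function at `s ≠ 1`. -/
def LFormula (q : ℂ_[p]) {f : ℕ} (χ : DirichletCharacter ℂ_[p] f) (F : ℕ) (s t : ℂ_[p]) :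
    ℂ_[p] :=
  1 / (s - 1) * (1 / qNum q (F : ℂ_[p]))
    * ∑ a ∈ units p F, χ (a : ZMod f) * ppow (angle q a t) (1 - s) * ∑' m : ℕ, LTerm q F a s t m

open Classical in
/-- The two-variable `p`-adic `q`-`L`-function `L_{p,q}(s, t | χ)`. At `s = 1` its value is the
limit of the defining formula. -/
def L (q : ℂ_[p]) {f : ℕ} (χ : DirichletCharacter ℂ_[p] f) (F : ℕ) (s t : ℂ_[p]) : ℂ_[p] :=
  if s = 1 then limUnder (𝓝[≠] (1 : ℂ_[p])) (fun s' => LFormula q χ F s' t)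
  else LFormula q χ F s t

/-- The term of index `m + 1` of the series in the value at `s = 1`, namely
`((-1)^k / k) β_{k,q^F} q^{(a + p^* t) k} ([F]_q / [a + p^* t]_q)^k` with `k = m + 1`. -/
def oneTerm (q : ℂ_[p]) (F a : ℕ) (t : ℂ_[p]) (m : ℕ) : ℂ_[p] :=
  (-1) ^ (m + 1) / ((m + 1 : ℕ) : ℂ_[p]) * qBernoulli (q ^ F) (m + 1)
    * ppow q (pt a t * ((m + 1 : ℕ) : ℂ_[p]))
    * (qNum q (F : ℂ_[p]) / qNum q (pt a t)) ^ (m + 1)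

end KimPadicL

end

/-!
The number `β_{n,q}` is `β_{0,q}` times the Volkenborn integral of `x ↦ [x]_q ^ n` over the
`p`-adic integers: these integrals satisfy the recursion that defines `β_{n,q}`, because
`[x + 1]_q = q [x]_q + 1`. As `[x]_q` is nonexpansive in `x`, it follows that `‖β_{n,q}‖ ≤ p`. Hence
the coefficients of the binomial series in the definition of `L_{p,q}(s, t | χ)` decay like
`‖F‖ ^ m`, and the series converges and is differentiable in `y = 1 - s` at `y = 0`, with
derivative minus the series in the value at `s = 1`. The sum over `a` vanishes at `y = 0`, since
`∑ χ(a) = 0`, so the pole at `s = 1` cancels and the limit is minus a derivative at `y = 0`.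
-/

noncomputable section

namespace KimPadicL

section Ultrametric

variable {K : Type*} [NormedField K] [IsUltrametricDist K]

lemma norm_le_one_of_norm_sub_one_le_one {u : K} (hu : ‖u - 1‖ ≤ 1) : ‖u‖ ≤ 1 := by
  simpa [hu] using IsUltrametricDist.norm_add_le_max (u - 1) 1

lemma norm_pow_sub_pow_le {a b : K} (ha : ‖a‖ ≤ 1) (hb : ‖b‖ ≤ 1) (n : ℕ) :
    ‖a ^ n - b ^ n‖ ≤ ‖a - b‖ := by
  rw [← (Commute.all a b).geom_sum₂_mul, norm_mul]
  refine mul_le_of_le_one_left (norm_nonneg _) ?_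
  refine IsUltrametricDist.norm_sum_le_of_forall_le_of_nonneg zero_le_one fun i _ => ?_
  rw [norm_mul, norm_pow, norm_pow]
  exact mul_le_one₀ (pow_le_one₀ (norm_nonneg _) ha) (by positivity)
    (pow_le_one₀ (norm_nonneg _) hb)

lemma norm_prod_sub_natCast_le (y : K) (s : Finset ℕ) :
    ‖∏ j ∈ s, (y - (j : K))‖ ≤ max 1 ‖y‖ ^ s.card := by
  rw [norm_prod]
  refine (Finset.prod_le_prod (fun _ _ => norm_nonneg _) fun j _ => ?_).trans_eq
    (Finset.prod_const _)
  rw [sub_eq_add_neg]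
  refine (IsUltrametricDist.norm_add_le_max _ _).trans (max_le (le_max_right _ _) ?_)
  rw [norm_neg]
  exact (IsUltrametricDist.norm_natCast_le_one K j).trans (le_max_left _ _)

end Ultrametric

section PowerSeries

variable {K : Type*} [NormedField K] {R : ℝ} {c : ℕ → K} {z : K}

lemma norm_mul_pow_succ_le (hR : 0 < R) (hc : ∀ n, ‖c n‖ * R ^ n ≤ 1) (z : K) (n : ℕ) :
    ‖c n * z ^ (n + 1)‖ ≤ ‖z‖ * (‖z‖ / R) ^ n := by
  rw [norm_mul, norm_pow, div_pow, mul_div_assoc', le_div_iff₀ (pow_pos hR n)]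
  calc ‖c n‖ * ‖z‖ ^ (n + 1) * R ^ n = (‖c n‖ * R ^ n) * (‖z‖ * ‖z‖ ^ n) := by ring
    _ ≤ ‖z‖ * ‖z‖ ^ n := mul_le_of_le_one_left (by positivity) (hc n)

lemma summable_norm_mul_div_pow (hR : 0 < R) (hz : ‖z‖ < R) :
    Summable fun n : ℕ => ‖z‖ * (‖z‖ / R) ^ n :=
  (summable_geometric_of_lt_one (by positivity) ((div_lt_one hR).mpr hz)).mul_left _

variable [CompleteSpace K]

lemma summable_mul_pow_succ (hR : 0 < R) (hc : ∀ n, ‖c n‖ * R ^ n ≤ 1) (hz : ‖z‖ < R) :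
    Summable fun n => c n * z ^ (n + 1) :=
  .of_norm_bounded (summable_norm_mul_div_pow hR hz) (norm_mul_pow_succ_le hR hc z)

lemma norm_tsum_mul_pow_succ [IsUltrametricDist K] (hR : 0 < R) (hc : ∀ n, ‖c n‖ * R ^ n ≤ 1)
    (hc0 : c 0 = 1) (hz : ‖z‖ < R) : ‖∑' n, c n * z ^ (n + 1)‖ = ‖z‖ := by
  rcases eq_or_ne z 0 with rfl | hz0
  · simp
  have hratio : ‖z‖ / R < 1 := (div_lt_one hR).mpr hz
  have htail : ‖∑' n, c (n + 1) * z ^ (n + 1 + 1)‖ < ‖z‖ := by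
    calc _ ≤ ‖z‖ * (‖z‖ / R) := IsUltrametricDist.norm_tsum_le_of_forall_le fun n =>
          (norm_mul_pow_succ_le hR hc z (n + 1)).trans <| by
            gcongr
            exact pow_le_of_le_one (by positivity) hratio.le n.succ_ne_zero
      _ < ‖z‖ := mul_lt_of_lt_one_right (norm_pos_iff.mpr hz0) hratio
  rw [(summable_mul_pow_succ hR hc hz).tsum_eq_zero_add, hc0, zero_add, pow_one, one_mul,
    IsUltrametricDist.norm_add_eq_max_of_norm_ne_norm htail.ne', max_eq_left htail.le]

end PowerSeries

variable {p : ℕ} [Fact p.Prime]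

lemma one_lt_cast_prime (p : ℕ) [Fact p.Prime] : (1 : ℝ) < p :=
  mod_cast (Fact.out : p.Prime).one_lt

lemma norm_natCast_eq_padicNorm (n : ℕ) : ‖(n : ℂ_[p])‖ = ‖(n : ℚ_[p])‖ := by
  rw [← map_natCast (algebraMap ℚ_[p] ℂ_[p]) n, norm_algebraMap']

lemma norm_natCast_le_one (n : ℕ) : ‖(n : ℂ_[p])‖ ≤ 1 :=
  IsUltrametricDist.norm_natCast_le_one _ n

lemma norm_natCast_le_of_dvd {m n : ℕ} (h : m ∣ n) : ‖(n : ℂ_[p])‖ ≤ ‖(m : ℂ_[p])‖ := by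
  obtain ⟨k, rfl⟩ := h
  rw [Nat.cast_mul, norm_mul]
  exact mul_le_of_le_one_right (norm_nonneg _) (norm_natCast_le_one k)

lemma norm_natCast_of_coprime {a : ℕ} (ha : a.Coprime p) : ‖(a : ℂ_[p])‖ = 1 := by
  rw [norm_natCast_eq_padicNorm, Padic.norm_natCast_eq_one_iff.mpr ha.symm]

lemma norm_natCast_prime : ‖(p : ℂ_[p])‖ = (p : ℝ)⁻¹ := by
  rw [norm_natCast_eq_padicNorm, Padic.norm_p]

lemma natCast_prime_pow_ne_zero (N : ℕ) : (p : ℂ_[p]) ^ N ≠ 0 :=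
  pow_ne_zero _ (mod_cast (Fact.out : p.Prime).ne_zero)

lemma tendsto_natCast_prime_pow : Tendsto (fun N : ℕ => (p : ℂ_[p]) ^ N) atTop (𝓝 0) :=
  tendsto_pow_atTop_nhds_zero_of_norm_lt_one <| by
    rw [norm_natCast_prime]
    exact inv_lt_one_of_one_lt₀ (one_lt_cast_prime p)

/-- The radius of convergence `p ^ (-1 / (p - 1))` of the `p`-adic exponential series, on whose
disc the exponential and the logarithm are mutually inverse isometries. -/
def expRadius (p : ℕ) : ℝ := (p : ℝ) ^ (-(1 / ((p : ℝ) - 1)))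

lemma expRadius_pos (p : ℕ) [Fact p.Prime] : 0 < expRadius p :=
  Real.rpow_pos_of_pos (by linarith [one_lt_cast_prime p]) _

lemma expRadius_lt_one (p : ℕ) [Fact p.Prime] : expRadius p < 1 :=
  Real.rpow_lt_one_of_one_lt_of_neg (one_lt_cast_prime p) <| by
    simp [one_lt_cast_prime p]

lemma expRadius_pow (p : ℕ) [Fact p.Prime] : expRadius p ^ (p - 1) = (p : ℝ)⁻¹ := by
  have hp := one_lt_cast_prime p
  have hp' : (p : ℝ) - 1 ≠ 0 := by linarith
  rw [expRadius, ← Real.rpow_natCast, ← Real.rpow_mul (by linarith),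
    Nat.cast_pred (Fact.out : p.Prime).pos, neg_mul, one_div_mul_cancel hp', Real.rpow_neg_one]

lemma expRadius_pow_le_norm_factorial_succ (n : ℕ) :
    expRadius p ^ n ≤ ‖((n + 1).factorial : ℂ_[p])‖ := by
  have hv := sub_one_mul_padicValNat_factorial_lt_of_ne_zero p n.succ_ne_zero
  rw [norm_natCast_eq_padicNorm, Padic.norm_eq_zpow_neg_valuation
    (mod_cast (n + 1).factorial_ne_zero), Padic.valuation_natCast, zpow_neg, zpow_natCast,
    ← inv_pow, ← expRadius_pow, ← pow_mul]
  exact pow_le_pow_of_le_one (expRadius_pos p).le (expRadius_lt_one p).le (Nat.lt_succ_iff.mp hv)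

lemma expRadius_pow_le_norm_factorial (n : ℕ) : expRadius p ^ n ≤ ‖(n.factorial : ℂ_[p])‖ := by
  cases n with
  | zero => simp
  | succ n =>
    exact (pow_le_pow_of_le_one (expRadius_pos p).le (expRadius_lt_one p).le n.le_succ).trans
      (expRadius_pow_le_norm_factorial_succ n)

lemma expRadius_pow_le_norm_succ (n : ℕ) : expRadius p ^ n ≤ ‖((n + 1 : ℕ) : ℂ_[p])‖ :=
  (expRadius_pow_le_norm_factorial_succ n).trans
    (norm_natCast_le_of_dvd (Nat.dvd_factorial n.succ_pos le_rfl))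

lemma norm_div_succ_mul_expRadius_pow_le {b : ℂ_[p]} (hb : ‖b‖ ≤ 1) (n : ℕ) :
    ‖b / ((n + 1 : ℕ) : ℂ_[p])‖ * expRadius p ^ n ≤ 1 := by
  rw [norm_div, div_mul_eq_mul_div]
  exact div_le_one_of_le₀ ((mul_le_of_le_one_left (pow_nonneg (expRadius_pos p).le n) hb).trans
    (expRadius_pow_le_norm_succ n)) (norm_nonneg _)

section Exp

lemma norm_inv_factorial_succ_mul_expRadius_pow_le (n : ℕ) :
    ‖((n + 1).factorial : ℂ_[p])⁻¹‖ * expRadius p ^ n ≤ 1 := by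
  rw [norm_inv, inv_mul_eq_div]
  exact div_le_one_of_le₀ (expRadius_pow_le_norm_factorial_succ n) (norm_nonneg _)

lemma exp_sub_one_eq_tsum {y : ℂ_[p]} (hy : ‖y‖ < expRadius p) :
    NormedSpace.exp y - 1 = ∑' n : ℕ, ((n + 1).factorial : ℂ_[p])⁻¹ * y ^ (n + 1) := by
  have hsum : Summable fun n : ℕ => (n.factorial : ℂ_[p])⁻¹ * y ^ n :=
    (summable_nat_add_iff 1).mp <| summable_mul_pow_succ (expRadius_pos p)
      norm_inv_factorial_succ_mul_expRadius_pow_le hy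
  simp_rw [NormedSpace.exp_eq_tsum_div, div_eq_inv_mul]
  rw [hsum.tsum_eq_zero_add]
  simp

lemma norm_exp_sub_one {y : ℂ_[p]} (hy : ‖y‖ < expRadius p) :
    ‖NormedSpace.exp y - 1‖ = ‖y‖ := by
  rw [exp_sub_one_eq_tsum hy]
  exact norm_tsum_mul_pow_succ (expRadius_pos p) norm_inv_factorial_succ_mul_expRadius_pow_le
    (by simp) hy

lemma norm_expSeries_mul_expRadius_pow_le (n : ℕ) :
    ‖NormedSpace.expSeries ℂ_[p] ℂ_[p] n‖ * expRadius p ^ n ≤ 1 := by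
  rw [NormedSpace.expSeries, norm_smul, ContinuousMultilinearMap.norm_mkPiAlgebraFin, mul_one,
    norm_inv, inv_mul_eq_div]
  exact div_le_one_of_le₀ (expRadius_pow_le_norm_factorial n) (norm_nonneg _)

lemma ofReal_expRadius_le_radius_expSeries :
    ENNReal.ofReal (expRadius p) ≤ (NormedSpace.expSeries ℂ_[p] ℂ_[p]).radius :=
  FormalMultilinearSeries.le_radius_of_bound _ 1 fun n => by
    rw [Real.coe_toNNReal _ (expRadius_pos p).le]
    exact norm_expSeries_mul_expRadius_pow_le n

lemma mem_eball_radius_expSeries {y : ℂ_[p]} (hy : ‖y‖ < expRadius p) :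
    y ∈ Metric.eball (0 : ℂ_[p]) (NormedSpace.expSeries ℂ_[p] ℂ_[p]).radius := by
  refine Metric.eball_subset_eball ofReal_expRadius_le_radius_expSeries ?_
  rwa [Metric.eball_ofReal, mem_ball_zero_iff]

lemma exp_natCast_mul {y : ℂ_[p]} (hy : ‖y‖ < expRadius p) (n : ℕ) :
    NormedSpace.exp ((n : ℂ_[p]) * y) = NormedSpace.exp y ^ n := by
  induction n with
  | zero => simp [NormedSpace.exp_zero]
  | succ n ih =>
    have hny : ‖(n : ℂ_[p]) * y‖ < expRadius p := by
      rw [norm_mul]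
      exact (mul_le_of_le_one_left (norm_nonneg _) (norm_natCast_le_one n)).trans_lt hy
    rw [Nat.cast_succ, add_one_mul, NormedSpace.exp_add_of_mem_ball (𝕂 := ℂ_[p])
      (mem_eball_radius_expSeries hny) (mem_eball_radius_expSeries hy), ih, pow_succ]

lemma hasDerivAt_exp_mul_const_zero (l : ℂ_[p]) :
    HasDerivAt (fun y : ℂ_[p] => NormedSpace.exp (y * l)) l 0 := by
  have hexp : HasDerivAt NormedSpace.exp (1 : ℂ_[p]) (0 * l) := by
    rw [zero_mul]
    exact hasDerivAt_exp_zero_of_radius_pos <|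
      (ENNReal.ofReal_pos.mpr (expRadius_pos p)).trans_le ofReal_expRadius_le_radius_expSeries
  have h := HasDerivAt.comp (0 : ℂ_[p]) hexp (hasDerivAt_mul_const l)
  rwa [one_mul] at h

end Exp

section Log

lemma plog_eq_tsum (u : ℂ_[p]) :
    plog u = ∑' n : ℕ, (-1) ^ n / ((n + 1 : ℕ) : ℂ_[p]) * (u - 1) ^ (n + 1) :=
  tsum_congr fun _ => mul_div_right_comm _ _ _

lemma norm_plog {u : ℂ_[p]} (hu : ‖u - 1‖ < expRadius p) : ‖plog u‖ = ‖u - 1‖ := by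
  rw [plog_eq_tsum]
  exact norm_tsum_mul_pow_succ (expRadius_pos p)
    (fun n => norm_div_succ_mul_expRadius_pow_le (by simp) n) (by simp) hu

lemma pow_sub_one_div_eq_tsum (u : ℂ_[p]) {n : ℕ} (hn : n ≠ 0) :
    (u ^ n - 1) / n =
      ∑' k : ℕ, ((n - 1).choose k : ℂ_[p]) / ((k + 1 : ℕ) : ℂ_[p]) * (u - 1) ^ (k + 1) := by
  obtain ⟨m, rfl⟩ := Nat.exists_eq_succ_of_ne_zero hn
  have hchoose (k : ℕ) :
      ((m + 1 : ℕ) : ℂ_[p]) * m.choose k = (m + 1).choose (k + 1) * (k + 1 : ℕ) :=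
    mod_cast Nat.add_one_mul_choose_eq m k
  have hbinom : u ^ (m + 1) - 1 =
      ∑ k ∈ Finset.range (m + 1), ((m + 1).choose (k + 1) : ℂ_[p]) * (u - 1) ^ (k + 1) := by
    nth_rewrite 1 [← sub_add_cancel u 1]
    rw [add_pow, Finset.sum_range_succ']
    simp [mul_comm]
  have hzero (k : ℕ) (hk : k ∉ Finset.range (m + 1)) :
      (m.choose k : ℂ_[p]) / ((k + 1 : ℕ) : ℂ_[p]) * (u - 1) ^ (k + 1) = 0 := by
    simp [Nat.choose_eq_zero_of_lt (by simpa using hk : m < k)]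
  rw [Nat.succ_eq_add_one, Nat.add_sub_cancel, tsum_eq_sum hzero, hbinom, Finset.sum_div]
  refine Finset.sum_congr rfl fun k _ => ?_
  have hm : ((m + 1 : ℕ) : ℂ_[p]) ≠ 0 := mod_cast m.succ_ne_zero
  have hk : ((k + 1 : ℕ) : ℂ_[p]) ≠ 0 := mod_cast k.succ_ne_zero
  rw [div_mul_eq_mul_div, div_eq_div_iff hm hk]
  linear_combination -(u - 1) ^ (k + 1) * hchoose k

lemma norm_pow_sub_one {u : ℂ_[p]} (hu : ‖u - 1‖ < expRadius p) (n : ℕ) :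
    ‖u ^ n - 1‖ = ‖(n : ℂ_[p])‖ * ‖u - 1‖ := by
  rcases eq_or_ne n 0 with rfl | hn
  · simp
  rw [← norm_tsum_mul_pow_succ (expRadius_pos p)
    (fun k => norm_div_succ_mul_expRadius_pow_le (norm_natCast_le_one ((n - 1).choose k)) k)
    (by simp) hu, ← pow_sub_one_div_eq_tsum u hn, ← norm_mul,
    mul_div_cancel₀ _ (Nat.cast_ne_zero.mpr hn)]

lemma tendsto_choose_prime_pow_sub_one (k : ℕ) :
    Tendsto (fun N : ℕ => ((p ^ N - 1).choose k : ℂ_[p])) atTop (𝓝 ((-1) ^ k)) := by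
  induction k with
  | zero => simp
  | succ k ih =>
    have hrec (N : ℕ) : ((p ^ N - 1).choose (k + 1) : ℂ_[p]) =
        (p : ℂ_[p]) ^ N * (p ^ N - 1).choose k / (k + 1 : ℕ) - (p ^ N - 1).choose k := by
      have hk : ((k + 1 : ℕ) : ℂ_[p]) ≠ 0 := mod_cast k.succ_ne_zero
      have hpN : p ^ N - 1 + 1 = p ^ N := Nat.sub_add_cancel (Nat.pow_pos (Fact.out : p.Prime).pos)
      have habs := Nat.add_one_mul_choose_eq (p ^ N - 1) k
      rw [hpN, ← hpN, Nat.choose_succ_succ, hpN] at habs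
      rw [eq_sub_iff_add_eq, eq_div_iff hk, add_comm]
      exact_mod_cast habs.symm
    simp_rw [hrec]
    simpa [pow_succ] using
      ((tendsto_natCast_prime_pow.mul ih).div_const ((k + 1 : ℕ) : ℂ_[p])).sub ih

lemma tendsto_pow_prime_pow_sub_one_div {u : ℂ_[p]} (hu : ‖u - 1‖ < expRadius p) :
    Tendsto (fun N : ℕ => (u ^ p ^ N - 1) / (p : ℂ_[p]) ^ N) atTop (𝓝 (plog u)) := by
  have hseries (N : ℕ) := pow_sub_one_div_eq_tsum u (pow_ne_zero N (Fact.out : p.Prime).ne_zero)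
  simp only [Nat.cast_pow] at hseries
  simp_rw [hseries, plog_eq_tsum]
  refine tendsto_tsum_of_dominated_convergence (summable_norm_mul_div_pow (expRadius_pos p) hu)
    (fun k => ((tendsto_choose_prime_pow_sub_one k).div_const _).mul_const _)
    (Eventually.of_forall fun N => norm_mul_pow_succ_le (expRadius_pos p) (fun k => ?_) _)
  exact norm_div_succ_mul_expRadius_pow_le (norm_natCast_le_one _) k

-- Both sides are the derivative of `x ↦ exp (x * y)` at `0`, computed along `x = p ^ N`.
lemma plog_exp {y : ℂ_[p]} (hy : ‖y‖ < expRadius p) : plog (NormedSpace.exp y) = y := by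
  have hlog := tendsto_pow_prime_pow_sub_one_div (u := NormedSpace.exp y)
    (by rwa [norm_exp_sub_one hy])
  have hslope := hasDerivAt_iff_tendsto_slope_zero.mp (hasDerivAt_exp_mul_const_zero y)
  have hpow : Tendsto (fun N : ℕ => (p : ℂ_[p]) ^ N) atTop (𝓝[≠] 0) :=
    tendsto_nhdsWithin_iff.mpr
      ⟨tendsto_natCast_prime_pow, Eventually.of_forall natCast_prime_pow_ne_zero⟩
  refine tendsto_nhds_unique hlog ((hslope.comp hpow).congr fun N => ?_)
  have hexp := exp_natCast_mul hy (p ^ N)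
  rw [Nat.cast_pow] at hexp
  simp [NormedSpace.exp_zero, hexp, div_eq_inv_mul]

end Log

section Volkenborn

/-- The `q`-analogue `[x]_q = 1 + q + ⋯ + q ^ (x - 1)` of a natural number `x`, written without
division so that it also makes sense for `q = 1`. -/
def qNat {R : Type*} [Semiring R] (q : R) (x : ℕ) : R := ∑ i ∈ Finset.range x, q ^ i

lemma qNat_zero {R : Type*} [Semiring R] (q : R) : qNat q 0 = 0 := Finset.sum_range_zero _

lemma qNat_succ {R : Type*} [Semiring R] (q : R) (x : ℕ) : qNat q (x + 1) = q * qNat q x + 1 :=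
  geom_sum_succ

lemma qNat_add {R : Type*} [Semiring R] (q : R) (x y : ℕ) :
    qNat q (x + y) = qNat q x + q ^ x * qNat q y := by
  simp only [qNat, Finset.sum_range_add, pow_add, Finset.mul_sum]

lemma qNat_eq_div {K : Type*} [Field K] {q : K} (hq1 : q ≠ 1) (x : ℕ) :
    qNat q x = (q ^ x - 1) / (q - 1) :=
  geom_sum_eq hq1 x

/-- The `N`-th Riemann sum `p ^ (-N) * ∑_{x < p ^ N} f x` of the Volkenborn integral of `f` over
the `p`-adic integers. -/
def volkenbornSum (f : ℕ → ℂ_[p]) (N : ℕ) : ℂ_[p] :=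
  (∑ x ∈ Finset.range (p ^ N), f x) / (p : ℂ_[p]) ^ N

lemma volkenbornSum_comp_succ_sub (f : ℕ → ℂ_[p]) (N : ℕ) :
    volkenbornSum (fun x => f (x + 1)) N - volkenbornSum f N =
      (f (p ^ N) - f 0) / (p : ℂ_[p]) ^ N := by
  rw [volkenbornSum, volkenbornSum, ← sub_div, ← Finset.sum_sub_distrib, Finset.sum_range_sub]

lemma volkenbornSum_one (N : ℕ) : volkenbornSum (fun _ => (1 : ℂ_[p])) N = 1 := by
  simp [volkenbornSum, natCast_prime_pow_ne_zero N]

lemma volkenbornSum_sum_const_mul {ι : Type*} (s : Finset ι) (c : ι → ℂ_[p])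
    (f : ι → ℕ → ℂ_[p]) (N : ℕ) :
    volkenbornSum (fun x => ∑ i ∈ s, c i * f i x) N = ∑ i ∈ s, c i * volkenbornSum (f i) N := by
  simp only [volkenbornSum]
  rw [Finset.sum_comm, Finset.sum_div]
  exact Finset.sum_congr rfl fun i _ => by rw [← Finset.mul_sum, mul_div_assoc]

section Lipschitz

variable {f : ℕ → ℂ_[p]} (hf : ∀ x y, ‖f (x + y) - f x‖ ≤ ‖(y : ℂ_[p])‖)
include hf

lemma norm_sum_range_mul_sub_le (M k : ℕ) :
    ‖∑ x ∈ Finset.range (M * k), f x - k * ∑ x ∈ Finset.range M, f x‖ ≤ ‖(M : ℂ_[p])‖ := by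
  induction k with
  | zero => simp
  | succ k ih =>
    have hsplit : ∑ x ∈ Finset.range (M * (k + 1)), f x -
          ((k + 1 : ℕ) : ℂ_[p]) * ∑ x ∈ Finset.range M, f x =
        (∑ x ∈ Finset.range (M * k), f x - k * ∑ x ∈ Finset.range M, f x) +
          ∑ x ∈ Finset.range M, (f (x + M * k) - f x) := by
      simp only [Nat.mul_succ, Finset.sum_range_add, Finset.sum_sub_distrib, add_comm _ (M * k)]
      push_cast
      ring
    rw [hsplit]
    refine (IsUltrametricDist.norm_add_le_max _ _).trans (max_le ih ?_)
    refine IsUltrametricDist.norm_sum_le_of_forall_le_of_nonneg (norm_nonneg _) fun x _ => ?_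
    exact (hf x (M * k)).trans (norm_natCast_le_of_dvd (dvd_mul_right M k))

lemma norm_volkenbornSum_succ_sub_le (N : ℕ) :
    ‖volkenbornSum f (N + 1) - volkenbornSum f N‖ ≤ p := by
  have hp : (p : ℂ_[p]) ≠ 0 := mod_cast (Fact.out : p.Prime).ne_zero
  have hpN := norm_pos_iff.mpr (natCast_prime_pow_ne_zero (p := p) N)
  have hdiff : volkenbornSum f (N + 1) - volkenbornSum f N =
      (∑ x ∈ Finset.range (p ^ N * p), f x - p * ∑ x ∈ Finset.range (p ^ N), f x) /
        ((p : ℂ_[p]) ^ N * p) := by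
    rw [volkenbornSum, volkenbornSum, sub_div, mul_comm _ (p : ℂ_[p]), mul_div_mul_left _ _ hp,
      pow_succ, pow_succ, mul_comm (p : ℂ_[p])]
  have hsum := norm_sum_range_mul_sub_le hf (p ^ N) p
  rw [Nat.cast_pow] at hsum
  rw [hdiff, norm_div, norm_mul, norm_natCast_prime, div_le_iff₀
    (mul_pos hpN (inv_pos.mpr (zero_lt_one.trans (one_lt_cast_prime p)))), mul_left_comm,
    mul_inv_cancel₀ (zero_lt_one.trans (one_lt_cast_prime p)).ne', mul_one]
  exact hsum

lemma norm_volkenbornSum_le (hf1 : ‖f 0‖ ≤ 1) (N : ℕ) : ‖volkenbornSum f N‖ ≤ p := by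
  induction N with
  | zero => simpa [volkenbornSum] using hf1.trans (one_lt_cast_prime p).le
  | succ N ih =>
    rw [← sub_add_cancel (volkenbornSum f (N + 1)) (volkenbornSum f N)]
    exact (IsUltrametricDist.norm_add_le_max _ _).trans
      (max_le (norm_volkenbornSum_succ_sub_le hf N) ih)

end Lipschitz

variable {q : ℂ_[p]} (hq : ‖q - 1‖ < expRadius p)
include hq

lemma norm_qNat (x : ℕ) : ‖qNat q x‖ = ‖(x : ℂ_[p])‖ := by
  rcases eq_or_ne q 1 with rfl | hq1
  · simp [qNat]
  · rw [qNat_eq_div hq1, norm_div, norm_pow_sub_one hq,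
      mul_div_cancel_right₀ _ (norm_ne_zero_iff.mpr (sub_ne_zero.mpr hq1))]

lemma norm_qNat_pow_add_sub_le (n x y : ℕ) :
    ‖qNat q (x + y) ^ n - qNat q x ^ n‖ ≤ ‖(y : ℂ_[p])‖ := by
  have hle (z : ℕ) : ‖qNat q z‖ ≤ 1 := (norm_qNat hq z).trans_le (norm_natCast_le_one z)
  refine (norm_pow_sub_pow_le (hle _) (hle _) n).trans ?_
  rw [qNat_add, add_sub_cancel_left, norm_mul, norm_pow, norm_qNat hq]
  exact mul_le_of_le_one_left (norm_nonneg _) <| pow_le_one₀ (norm_nonneg _) <|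
    norm_le_one_of_norm_sub_one_le_one (hq.trans (expRadius_lt_one p)).le

omit hq in
lemma volkenbornSum_qNat_pow_succ (q : ℂ_[p]) (n N : ℕ) :
    volkenbornSum (fun x => qNat q x ^ (n + 1)) N * (q ^ (n + 1) - 1) =
      qNat q (p ^ N) ^ (n + 1) / (p : ℂ_[p]) ^ N -
        ∑ i ∈ Finset.range (n + 1), ((n + 1).choose i : ℂ_[p]) * q ^ i *
          volkenbornSum (fun x => qNat q x ^ i) N := by
  have hexpand (x : ℕ) : qNat q (x + 1) ^ (n + 1) =
      ∑ i ∈ Finset.range (n + 2), ((n + 1).choose i : ℂ_[p]) * q ^ i * qNat q x ^ i := by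
    rw [qNat_succ, add_pow]
    exact Finset.sum_congr rfl fun i _ => by ring
  have hshift := volkenbornSum_comp_succ_sub (fun x => qNat q x ^ (n + 1)) N
  simp only [hexpand, qNat_zero, volkenbornSum_sum_const_mul] at hshift
  rw [Finset.sum_range_succ, Nat.choose_self, zero_pow n.succ_ne_zero, sub_zero] at hshift
  linear_combination hshift

omit hq in
lemma qBernoulli_succ (q : ℂ_[p]) (n : ℕ) :
    qBernoulli q (n + 1) = ((if n + 1 = 1 then 1 else 0) -
      ∑ i ∈ Finset.range (n + 1), ((n + 1).choose i : ℂ_[p]) * q ^ i * qBernoulli q i) /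
        (q ^ (n + 1) - 1) := by
  rw [qBernoulli, Fin.sum_univ_eq_sum_range
    (fun i => ((n + 1).choose i : ℂ_[p]) * q ^ i * qBernoulli q i)]

variable (hq1 : q ≠ 1)
include hq1

lemma pow_ne_one {n : ℕ} (hn : n ≠ 0) : q ^ n ≠ 1 := by
  rw [← sub_ne_zero, ← norm_ne_zero_iff, norm_pow_sub_one hq]
  exact mul_ne_zero (norm_ne_zero_iff.mpr (mod_cast hn))
    (norm_ne_zero_iff.mpr (sub_ne_zero.mpr hq1))

lemma norm_qBernoulli_zero : ‖qBernoulli q 0‖ = 1 := by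
  rw [qBernoulli, norm_div, norm_plog hq,
    div_self (norm_ne_zero_iff.mpr (sub_ne_zero.mpr hq1))]

lemma tendsto_qNat_prime_pow_div :
    Tendsto (fun N : ℕ => qNat q (p ^ N) / (p : ℂ_[p]) ^ N) atTop (𝓝 (qBernoulli q 0)⁻¹) := by
  rw [qBernoulli, inv_div]
  refine ((tendsto_pow_prime_pow_sub_one_div hq).div_const (q - 1)).congr fun N => ?_
  rw [qNat_eq_div hq1, div_right_comm]

lemma tendsto_qNat_prime_pow : Tendsto (fun N : ℕ => qNat q (p ^ N)) atTop (𝓝 0) := by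
  have h := (tendsto_qNat_prime_pow_div hq hq1).mul tendsto_natCast_prime_pow
  simpa [natCast_prime_pow_ne_zero] using h

lemma tendsto_volkenbornSum_qNat_pow (n : ℕ) :
    Tendsto (fun N => qBernoulli q 0 * volkenbornSum (fun x => qNat q x ^ n) N) atTop
      (𝓝 (qBernoulli q n)) := by
  induction n using Nat.strong_induction_on with
  | _ n ih =>
  rcases n with _ | n
  · simp [volkenbornSum_one]
  have hβ : qBernoulli q 0 ≠ 0 :=
    norm_ne_zero_iff.mp ((norm_qBernoulli_zero hq hq1).trans_ne one_ne_zero)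
  have hboundary : Tendsto (fun N : ℕ => qBernoulli q 0 *
      (qNat q (p ^ N) ^ (n + 1) / (p : ℂ_[p]) ^ N)) atTop (𝓝 (if n + 1 = 1 then 1 else 0)) := by
    have h := (((tendsto_qNat_prime_pow hq hq1).pow n).mul
      (tendsto_qNat_prime_pow_div hq hq1)).const_mul (qBernoulli q 0)
    rw [mul_left_comm, mul_inv_cancel₀ hβ, mul_one, zero_pow_eq] at h
    simpa [pow_succ, mul_div_assoc] using h
  have hsum := tendsto_finsetSum (Finset.range (n + 1)) fun i hi =>
    (ih i (Finset.mem_range.mp hi)).const_mul (((n + 1).choose i : ℂ_[p]) * q ^ i)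
  rw [qBernoulli_succ]
  refine ((hboundary.sub hsum).div_const (q ^ (n + 1) - 1)).congr fun N => ?_
  rw [div_eq_iff (sub_ne_zero.mpr (pow_ne_one hq hq1 n.succ_ne_zero)), mul_assoc,
    volkenbornSum_qNat_pow_succ, mul_sub, Finset.mul_sum]
  exact congrArg _ (Finset.sum_congr rfl fun i _ => mul_left_comm _ _ _)

lemma norm_qBernoulli_le (n : ℕ) : ‖qBernoulli q n‖ ≤ p := by
  refine le_of_tendsto (tendsto_volkenbornSum_qNat_pow hq hq1 n).norm
    (Eventually.of_forall fun N => ?_)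
  rw [norm_mul, norm_qBernoulli_zero hq hq1, one_mul]
  refine norm_volkenbornSum_le (norm_qNat_pow_add_sub_le hq n) ?_ N
  rw [qNat_zero, norm_pow, norm_zero]
  exact pow_le_one₀ le_rfl zero_le_one

end Volkenborn

section QNumber

lemma norm_pStar_lt_expRadius : ‖(pStar p : ℂ_[p])‖ < expRadius p := by
  have h0 := expRadius_pos p
  have h1 := expRadius_lt_one p
  have hpow := expRadius_pow p
  rw [pStar]
  split_ifs with hp2
  · subst hp2
    have hfour : ((4 : ℕ) : ℂ_[2]) = ((2 : ℕ) : ℂ_[2]) * ((2 : ℕ) : ℂ_[2]) := by norm_num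
    rw [hfour, norm_mul, norm_natCast_prime, ← hpow, Nat.add_one_sub_one, pow_one]
    exact mul_lt_of_lt_one_right h0 h1
  · rw [norm_natCast_prime, ← hpow]
    have := (Fact.out : p.Prime).two_le
    exact pow_lt_self_of_lt_one₀ h0 h1 (by omega)

lemma norm_pStar_mul_lt_one {t : ℂ_[p]} (ht : ‖t‖ ≤ 1) : ‖(pStar p : ℂ_[p]) * t‖ < 1 := by
  rw [norm_mul]
  exact (mul_le_of_le_one_right (norm_nonneg _) ht).trans_lt
    (norm_pStar_lt_expRadius.trans (expRadius_lt_one p))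

lemma dvd_pStar (p : ℕ) : p ∣ pStar p := by
  rw [pStar]
  split_ifs with hp2
  · subst hp2
    norm_num
  · exact dvd_rfl

lemma norm_pt {a : ℕ} (ha : a.Coprime p) {t : ℂ_[p]} (ht : ‖(pStar p : ℂ_[p]) * t‖ < 1) :
    ‖pt a t‖ = 1 := by
  have ha1 : ‖(a : ℂ_[p])‖ = 1 := norm_natCast_of_coprime ha
  rw [pt, IsUltrametricDist.norm_add_eq_max_of_norm_ne_norm (ha1.trans_ne ht.ne'), ha1,
    max_eq_left ht.le]

lemma ppow_zero (u : ℂ_[p]) : ppow u 0 = 1 := by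
  rw [ppow, zero_mul, NormedSpace.exp_zero]

variable {q x : ℂ_[p]} (hq : ‖q - 1‖ < expRadius p) (hx : ‖x‖ ≤ 1)
include hq hx

lemma norm_mul_plog_lt : ‖x * plog q‖ < expRadius p := by
  rw [norm_mul, norm_plog hq]
  exact (mul_le_of_le_one_left (norm_nonneg _) hx).trans_lt hq

lemma norm_ppow_sub_one : ‖ppow q x - 1‖ = ‖x‖ * ‖q - 1‖ := by
  rw [ppow, norm_exp_sub_one (norm_mul_plog_lt hq hx), norm_mul, norm_plog hq]

lemma norm_ppow_le_one : ‖ppow q x‖ ≤ 1 :=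
  norm_le_one_of_norm_sub_one_le_one <| (norm_ppow_sub_one hq hx).trans_le <|
    mul_le_one₀ hx (norm_nonneg _) (hq.trans (expRadius_lt_one p)).le

lemma norm_qNum (hq1 : q ≠ 1) : ‖qNum q x‖ = ‖x‖ := by
  rw [qNum, norm_div, norm_sub_rev, norm_sub_rev 1 q, norm_ppow_sub_one hq hx,
    mul_div_cancel_right₀ _ (norm_ne_zero_iff.mpr (sub_ne_zero.mpr hq1))]

lemma ppow_ppow (y : ℂ_[p]) : ppow (ppow q x) y = ppow q (y * x) := by
  simp only [ppow, plog_exp (norm_mul_plog_lt hq hx), mul_assoc]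

lemma qNum_ppow_div (hq1 : q ≠ 1) (hx0 : x ≠ 0) (y : ℂ_[p]) :
    qNum (ppow q x) (y / x) = qNum q y / qNum q x := by
  rw [qNum, ppow_ppow hq hx, div_mul_cancel₀ y hx0, qNum, qNum,
    div_div_div_cancel_right₀ (sub_ne_zero.mpr hq1.symm)]

end QNumber

section BinomialSeries

section Choose

variable {K : Type*} [Field K] [CharZero K]

lemma choose_eq_prod_range_div (y : K) (m : ℕ) :
    Ring.choose y m = (∏ j ∈ Finset.range m, (y - j)) / m.factorial := by
  rw [Ring.choose_eq_smul, ← Polynomial.aeval_eq_smeval, Polynomial.aeval_def,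
    Polynomial.eval₂_eq_eval_map, descPochhammer_map, descPochhammer_eval_eq_prod_range,
    smul_eq_mul, inv_mul_eq_div]

lemma choose_succ_eq_mul_prod_Ico_div (y : K) (m : ℕ) :
    Ring.choose y (m + 1) = y * ((∏ j ∈ Finset.Ico 1 (m + 1), (y - j)) / (m + 1).factorial) := by
  rw [choose_eq_prod_range_div, Finset.range_eq_Ico,
    Finset.prod_eq_prod_Ico_succ_bot m.succ_pos, Nat.cast_zero, sub_zero, mul_div_assoc, zero_add]

lemma prod_Ico_zero_sub_div_factorial (m : ℕ) :
    (∏ j ∈ Finset.Ico 1 (m + 1), ((0 : K) - j)) / (m + 1).factorial =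
      (-1) ^ m / ((m + 1 : ℕ) : K) := by
  have hm : (m.factorial : K) ≠ 0 := mod_cast m.factorial_ne_zero
  simp only [zero_sub]
  rw [Finset.prod_neg, Nat.card_Ico, Nat.add_sub_cancel, ← Nat.cast_prod,
    Finset.prod_Ico_id_eq_factorial, Nat.factorial_succ, Nat.cast_mul, mul_div_mul_right _ _ hm]

lemma tsum_choose_zero_mul [TopologicalSpace K] (c : ℕ → K) :
    ∑' m, Ring.choose (0 : K) m * c m = c 0 := by
  rw [tsum_eq_single 0 fun m hm => by rw [Ring.choose_zero_pos K (Nat.pos_of_ne_zero hm), zero_mul],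
    Ring.choose_zero_right, one_mul]

end Choose

lemma tendsto_choose_succ_div {K : Type*} [NormedField K] [CharZero K] (m : ℕ) :
    Tendsto (fun y : K => Ring.choose y (m + 1) / y) (𝓝[≠] 0)
      (𝓝 ((-1) ^ m / ((m + 1 : ℕ) : K))) := by
  have hcont : Continuous fun y : K =>
      (∏ j ∈ Finset.Ico 1 (m + 1), (y - j)) / ((m + 1).factorial : K) := by fun_prop
  rw [← prod_Ico_zero_sub_div_factorial]
  refine ((hcont.tendsto 0).mono_left nhdsWithin_le_nhds).congr' ?_
  filter_upwards [self_mem_nhdsWithin] with y hy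
  rw [choose_succ_eq_mul_prod_Ico_div, mul_div_cancel_left₀ _ hy]

lemma norm_choose_mul_expRadius_pow_le (y : ℂ_[p]) (m : ℕ) :
    ‖Ring.choose y m‖ * expRadius p ^ m ≤ max 1 ‖y‖ ^ m := by
  have hprod := norm_prod_sub_natCast_le y (Finset.range m)
  rw [Finset.card_range] at hprod
  rw [choose_eq_prod_range_div, norm_div, div_mul_eq_mul_div,
    div_le_iff₀ (norm_pos_iff.mpr (mod_cast m.factorial_ne_zero))]
  exact mul_le_mul hprod (expRadius_pow_le_norm_factorial m) (pow_pos (expRadius_pos p) m).le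
    (by positivity)

lemma norm_choose_succ_div_mul_expRadius_pow_le {y : ℂ_[p]} (hy : ‖y‖ ≤ 1) (hy0 : y ≠ 0) (m : ℕ) :
    ‖Ring.choose y (m + 1) / y‖ * expRadius p ^ m ≤ 1 := by
  have hprod := norm_prod_sub_natCast_le y (Finset.Ico 1 (m + 1))
  rw [max_eq_left hy, one_pow] at hprod
  rw [choose_succ_eq_mul_prod_Ico_div, mul_div_cancel_left₀ _ hy0, norm_div, div_mul_eq_mul_div]
  refine div_le_one_of_le₀ ?_ (norm_nonneg _)
  exact (mul_le_of_le_one_left (pow_pos (expRadius_pos p) m).le hprod).trans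
    (expRadius_pow_le_norm_factorial_succ m)

variable {c : ℕ → ℂ_[p]} {C ρ : ℝ} (hc : ∀ m, ‖c m‖ ≤ C * ρ ^ m)
include hc

lemma norm_mul_succ_le_of_mul_expRadius_pow_le {b : ℂ_[p]} {m : ℕ}
    (hb : ‖b‖ * expRadius p ^ m ≤ 1) :
    ‖b * c (m + 1)‖ ≤ C * ρ * (ρ / expRadius p) ^ m := by
  rw [norm_mul, div_pow, mul_div_assoc', le_div_iff₀ (pow_pos (expRadius_pos p) m)]
  calc ‖b‖ * ‖c (m + 1)‖ * expRadius p ^ m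
      = ‖b‖ * expRadius p ^ m * ‖c (m + 1)‖ := mul_right_comm _ _ _
    _ ≤ ‖c (m + 1)‖ := mul_le_of_le_one_left (norm_nonneg _) hb
    _ ≤ C * ρ ^ (m + 1) := hc (m + 1)
    _ = C * ρ * ρ ^ m := by ring

variable (hρ : 0 ≤ ρ)
include hρ

lemma summable_choose_mul {y : ℂ_[p]} (hy : ρ * max 1 ‖y‖ < expRadius p) :
    Summable fun m => Ring.choose y m * c m := by
  have hR := expRadius_pos p
  have hratio : ρ * max 1 ‖y‖ / expRadius p < 1 := (div_lt_one hR).mpr hy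
  refine .of_norm_bounded ((summable_geometric_of_lt_one (by positivity) hratio).mul_left C)
    fun m => ?_
  rw [norm_mul, div_pow, mul_div_assoc', le_div_iff₀ (pow_pos hR m)]
  calc ‖Ring.choose y m‖ * ‖c m‖ * expRadius p ^ m
      = ‖Ring.choose y m‖ * expRadius p ^ m * ‖c m‖ := mul_right_comm _ _ _
    _ ≤ max 1 ‖y‖ ^ m * (C * ρ ^ m) := by
        gcongr
        exacts [norm_choose_mul_expRadius_pow_le y m, hc m]
    _ = C * (ρ * max 1 ‖y‖) ^ m := by ring

omit hc in
lemma summable_mul_div_expRadius_pow (hρR : ρ < expRadius p) (C : ℝ) :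
    Summable fun m : ℕ => C * (ρ / expRadius p) ^ m :=
  (summable_geometric_of_lt_one (div_nonneg hρ (expRadius_pos p).le)
    ((div_lt_one (expRadius_pos p)).mpr hρR)).mul_left C

variable (hρR : ρ < expRadius p)
include hρR

lemma summable_neg_one_pow_div_succ_mul :
    Summable fun m : ℕ => (-1) ^ m / ((m + 1 : ℕ) : ℂ_[p]) * c (m + 1) :=
  .of_norm_bounded (summable_mul_div_expRadius_pow hρ hρR (C * ρ)) fun m =>
    norm_mul_succ_le_of_mul_expRadius_pow_le hc
      (norm_div_succ_mul_expRadius_pow_le (by simp) m)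

lemma hasDerivAt_tsum_choose_mul :
    HasDerivAt (fun y => ∑' m, Ring.choose y m * c m)
      (∑' m : ℕ, (-1) ^ m / ((m + 1 : ℕ) : ℂ_[p]) * c (m + 1)) 0 := by
  have hunit : ∀ᶠ y : ℂ_[p] in 𝓝[≠] 0, ‖y‖ ≤ 1 ∧ y ≠ 0 := by
    filter_upwards [nhdsWithin_le_nhds (Metric.closedBall_mem_nhds 0 one_pos),
      self_mem_nhdsWithin] with y hy hy0
    exact ⟨mem_closedBall_zero_iff.mp hy, hy0⟩
  have hdominated : Tendsto (fun y : ℂ_[p] => ∑' m, Ring.choose y (m + 1) / y * c (m + 1))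
      (𝓝[≠] 0) (𝓝 (∑' m : ℕ, (-1) ^ m / ((m + 1 : ℕ) : ℂ_[p]) * c (m + 1))) :=
    tendsto_tsum_of_dominated_convergence (summable_mul_div_expRadius_pow hρ hρR (C * ρ))
      (fun m => (tendsto_choose_succ_div m).mul_const _)
      (hunit.mono fun y hy m => norm_mul_succ_le_of_mul_expRadius_pow_le hc
        (norm_choose_succ_div_mul_expRadius_pow_le hy.1 hy.2 m))
  refine hasDerivAt_iff_tendsto_slope_zero.mpr (hdominated.congr' (hunit.mono fun y hy => ?_))
  have hsum : Summable fun m => Ring.choose y m * c m :=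
    summable_choose_mul hc hρ (by rwa [max_eq_left hy.1, mul_one])
  beta_reduce
  rw [tsum_choose_zero_mul, zero_add, hsum.tsum_eq_zero_add, Ring.choose_zero_right, one_mul,
    add_sub_cancel_left, smul_eq_mul, ← tsum_mul_left]
  exact tsum_congr fun m => by ring

end BinomialSeries

section CharacterSum

lemma sum_monoidHom_eq_zero {M R : Type*} [Monoid M] [Fintype M] [CommRing R] [IsDomain R]
    (φ : M →* R) {u : Mˣ} (hu : φ u ≠ 1) : ∑ x, φ x = 0 :=
  eq_zero_of_mul_eq_self_left hu <| by
    simpa only [Finset.mul_sum, ← map_mul] using u.mulLeft_bijective.sum_comp _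

lemma sum_Icc_natCast_zmod {A : Type*} [AddCommMonoid A] {n : ℕ} [NeZero n] (g : ZMod n → A) :
    ∑ a ∈ Finset.Icc 1 n, g a = ∑ x, g x := by
  have hrange : ∑ a ∈ Finset.range n, g (a + 1) = ∑ x : ZMod n, g (x + 1) :=
    Finset.sum_nbij' (fun a => (a : ZMod n)) ZMod.val (by simp)
      (fun x _ => Finset.mem_range.mpr x.val_lt)
      (fun a ha => ZMod.val_cast_of_lt (by simpa using ha)) (by simp) (by simp)
  rw [← Equiv.sum_comp (Equiv.addRight (1 : ZMod n)) g, ← Finset.Ico_add_one_right_eq_Icc,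
    Finset.sum_Ico_eq_sum_range]
  simpa [add_comm] using hrange

lemma sum_filter_coprime_dirichletCharacter_eq_zero {R : Type*} [CommRing R] [IsDomain R]
    {f d n : ℕ} [NeZero n] (hf : f ∣ n) (hd : d ∣ n) {χ : DirichletCharacter R f} (hχ : χ ≠ 1) :
    ∑ a ∈ (Finset.Icc 1 n).filter (fun a => a.Coprime d), χ (a : ZMod f) = 0 := by
  set φ : ZMod n →* R := (χ.toMonoidHom.comp (ZMod.castHom hf (ZMod f))) *
    ((1 : DirichletCharacter R d).toMonoidHom.comp (ZMod.castHom hd (ZMod d)))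
  have hφ (a : ℕ) : φ a = if a.Coprime d then χ (a : ZMod f) else 0 := by
    split_ifs with had
    · simp [φ, MulChar.one_apply ((ZMod.isUnit_iff_coprime a d).mpr had)]
    · simp [φ, MulChar.map_nonunit _ (mt (ZMod.isUnit_iff_coprime a d).mp had)]
  obtain ⟨u, hu⟩ := MulChar.ne_one_iff.mp hχ
  obtain ⟨v, rfl⟩ := ZMod.unitsMap_surjective hf u
  have hv : φ v ≠ 1 := by
    simpa [φ, MulChar.one_apply (ZMod.isUnit_cast_of_dvd hd v), ZMod.unitsMap_val] using hu
  rw [Finset.sum_filter]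
  calc _ = ∑ a ∈ Finset.Icc 1 n, φ a := Finset.sum_congr rfl fun a _ => (hφ a).symm
    _ = ∑ x, φ x := sum_Icc_natCast_zmod fun x => φ x
    _ = 0 := sum_monoidHom_eq_zero φ hv

end CharacterSum

section LFunction

/-- The factor `β_{m,q^F} q^{x m} ([F]_q / [x]_q)^m` that, at `x = a + p^* t`, the `m`-th terms of
the series for `L_{p,q}(s, t | χ)` and for its value at `s = 1` have in common. -/
def seriesCoeff (q : ℂ_[p]) (F : ℕ) (x : ℂ_[p]) (m : ℕ) : ℂ_[p] :=
  qBernoulli (q ^ F) m * ppow q (x * (m : ℂ_[p])) * (qNum q (F : ℂ_[p]) / qNum q x) ^ m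

/-- The sum over `a` in the formula for `L_{p,q}(s, t | χ)`, as a function of `y = 1 - s`. -/
def twistedSum (q : ℂ_[p]) {f : ℕ} (χ : DirichletCharacter ℂ_[p] f) (F : ℕ) (t y : ℂ_[p]) :
    ℂ_[p] :=
  ∑ a ∈ units p F, χ (a : ZMod f) *
    (ppow (angle q a t) y * ∑' m, Ring.choose y m * seriesCoeff q F (pt a t) m)

lemma seriesCoeff_zero (q : ℂ_[p]) (F : ℕ) (x : ℂ_[p]) :
    seriesCoeff q F x 0 = qBernoulli (q ^ F) 0 := by
  simp [seriesCoeff, ppow_zero]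

lemma oneTerm_eq_neg (q : ℂ_[p]) (F a : ℕ) (t : ℂ_[p]) (m : ℕ) :
    oneTerm q F a t m =
      -((-1) ^ m / ((m + 1 : ℕ) : ℂ_[p]) * seriesCoeff q F (pt a t) (m + 1)) := by
  rw [oneTerm, seriesCoeff, pow_succ (-1)]
  ring

lemma coprime_of_mem_units {p F a : ℕ} (ha : a ∈ units p F) : a.Coprime p :=
  (Finset.mem_filter.mp ha).2

lemma norm_natCast_lt_expRadius {F : ℕ} (hpF : pStar p ∣ F) : ‖(F : ℂ_[p])‖ < expRadius p :=
  (norm_natCast_le_of_dvd hpF).trans_lt norm_pStar_lt_expRadius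

variable {q : ℂ_[p]} (hq : ‖q - 1‖ < expRadius p) (hq1 : q ≠ 1) {F : ℕ}
include hq hq1

lemma norm_seriesCoeff_le (hF : F ≠ 0) {x : ℂ_[p]} (hx : ‖x‖ = 1) (m : ℕ) :
    ‖seriesCoeff q F x m‖ ≤ p * ‖(F : ℂ_[p])‖ ^ m := by
  have hF1 : ‖(F : ℂ_[p])‖ ≤ 1 := norm_natCast_le_one F
  have hxm : ‖x * (m : ℂ_[p])‖ ≤ 1 := by
    rw [norm_mul, hx, one_mul]
    exact norm_natCast_le_one m
  have hqF : ‖q ^ F - 1‖ < expRadius p := by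
    rw [norm_pow_sub_one hq]
    exact (mul_le_of_le_one_left (norm_nonneg _) hF1).trans_lt hq
  rw [seriesCoeff, norm_mul, norm_mul, norm_pow, norm_div, norm_qNum hq hF1 hq1,
    norm_qNum hq hx.le hq1, hx, div_one]
  gcongr
  exact (mul_le_of_le_one_right (norm_nonneg _) (norm_ppow_le_one hq hxm)).trans
    (norm_qBernoulli_le hqF (pow_ne_one hq hq1 hF) m)

variable {t : ℂ_[p]} (ht : ‖(pStar p : ℂ_[p]) * t‖ < 1)
include ht

lemma LTerm_eq_choose_mul {a : ℕ} (ha : a.Coprime p) (s : ℂ_[p]) (m : ℕ) :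
    LTerm q F a s t m = Ring.choose (1 - s) m * seriesCoeff q F (pt a t) m := by
  have hx : ‖pt a t‖ = 1 := norm_pt ha ht
  have hx0 : pt a t ≠ 0 := norm_ne_zero_iff.mp (hx.trans_ne one_ne_zero)
  rw [LTerm, seriesCoeff, qNum_ppow_div hq hx.le hq1 hx0]
  ring

lemma LFormula_eq_twistedSum {f : ℕ} (χ : DirichletCharacter ℂ_[p] f) (s : ℂ_[p]) :
    LFormula q χ F s t =
      1 / qNum q (F : ℂ_[p]) * (twistedSum q χ F t (1 - s) / (s - 1)) := by
  have hsum : ∑ a ∈ units p F,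
      χ (a : ZMod f) * ppow (angle q a t) (1 - s) * ∑' m, LTerm q F a s t m =
      twistedSum q χ F t (1 - s) := by
    refine Finset.sum_congr rfl fun a ha => ?_
    rw [mul_assoc, tsum_congr (LTerm_eq_choose_mul hq hq1 ht (coprime_of_mem_units ha) s)]
  rw [LFormula, hsum]
  ring

lemma summable_LTerm (hF : F ≠ 0) (hpF : pStar p ∣ F) {a : ℕ} (ha : a.Coprime p) {s : ℂ_[p]}
    (hs : ‖(F : ℂ_[p])‖ * ‖s - 1‖ < expRadius p) : Summable (LTerm q F a s t) := by
  have hradius : ‖(F : ℂ_[p])‖ * max 1 ‖1 - s‖ < expRadius p := by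
    rw [mul_max_of_nonneg _ _ (norm_nonneg _), mul_one, norm_sub_rev]
    exact max_lt (norm_natCast_lt_expRadius hpF) hs
  exact (summable_choose_mul (norm_seriesCoeff_le hq hq1 hF (norm_pt ha ht)) (norm_nonneg _)
    hradius).congr fun m => (LTerm_eq_choose_mul hq hq1 ht ha s m).symm

lemma summable_oneTerm (hF : F ≠ 0) (hpF : pStar p ∣ F) {a : ℕ} (ha : a.Coprime p) :
    Summable (oneTerm q F a t) :=
  (summable_neg_one_pow_div_succ_mul (norm_seriesCoeff_le hq hq1 hF (norm_pt ha ht))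
    (norm_nonneg _) (norm_natCast_lt_expRadius hpF)).neg.congr
    fun m => (oneTerm_eq_neg q F a t m).symm

lemma hasDerivAt_ppow_mul_tsum_choose (hF : F ≠ 0) (hpF : pStar p ∣ F) {a : ℕ}
    (ha : a.Coprime p) (u : ℂ_[p]) :
    HasDerivAt (fun y => ppow u y * ∑' m, Ring.choose y m * seriesCoeff q F (pt a t) m)
      (qBernoulli (q ^ F) 0 * plog u - ∑' m, oneTerm q F a t m) 0 := by
  have h := (hasDerivAt_exp_mul_const_zero (plog u)).mul
    (hasDerivAt_tsum_choose_mul (norm_seriesCoeff_le hq hq1 hF (norm_pt ha ht)) (norm_nonneg _)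
      (norm_natCast_lt_expRadius hpF))
  rw [tsum_choose_zero_mul, seriesCoeff_zero, zero_mul, NormedSpace.exp_zero, one_mul] at h
  simp only [oneTerm_eq_neg, tsum_neg, sub_neg_eq_add]
  rw [mul_comm (qBernoulli _ _)]
  exact h

omit hq hq1 ht in
lemma twistedSum_zero [NeZero F] (q t : ℂ_[p]) (hpF : p ∣ F) {f : ℕ} (hfF : f ∣ F)
    {χ : DirichletCharacter ℂ_[p] f} (hχ : χ ≠ 1) : twistedSum q χ F t 0 = 0 := by
  simp only [twistedSum, ppow_zero, one_mul, tsum_choose_zero_mul, seriesCoeff_zero]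
  rw [← Finset.sum_mul, units,
    sum_filter_coprime_dirichletCharacter_eq_zero hfF hpF hχ, zero_mul]

lemma tendsto_LFormula (hF : F ≠ 0) (hpF : pStar p ∣ F) {f : ℕ} (hfF : f ∣ F)
    {χ : DirichletCharacter ℂ_[p] f} (hχ : χ ≠ 1) :
    Tendsto (fun s => LFormula q χ F s t) (𝓝[≠] 1)
      (𝓝 (1 / qNum q (F : ℂ_[p]) * ∑ a ∈ units p F, χ (a : ZMod f) *
        (-(qBernoulli (q ^ F) 0 * plog (angle q a t)) + ∑' m : ℕ, oneTerm q F a t m))) := by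
  have : NeZero F := ⟨hF⟩
  have hderiv : HasDerivAt (twistedSum q χ F t) (∑ a ∈ units p F, χ (a : ZMod f) *
      (qBernoulli (q ^ F) 0 * plog (angle q a t) - ∑' m, oneTerm q F a t m)) (1 - 1) := by
    rw [sub_self]
    exact HasDerivAt.fun_sum fun a ha => (hasDerivAt_ppow_mul_tsum_choose hq hq1 ht hF hpF
      (coprime_of_mem_units ha) (angle q a t)).const_mul (χ (a : ZMod f))
  have hslope := (hasDerivAt_iff_tendsto_slope.mp (hderiv.comp_const_sub 1 1)).const_mul
    (1 / qNum q (F : ℂ_[p]))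
  simp only [slope_def_field, sub_self, twistedSum_zero q t ((dvd_pStar p).trans hpF) hfF hχ,
    sub_zero, ← Finset.sum_neg_distrib, ← mul_neg, neg_sub'] at hslope
  simpa only [LFormula_eq_twistedSum hq hq1 ht, mul_neg, sub_neg_eq_add] using hslope

end LFunction

end KimPadicL

end

theorem theorem8_general (p : ℕ) [Fact p.Prime] (q : ℂ_[p]) (hq1 : q ≠ 1)
    (hq : ‖1 - q‖ < KimPadicL.expRadius p) {f : ℕ} (χ : DirichletCharacter ℂ_[p] f) (hχ1 : χ ≠ 1)
    (F : ℕ) (hF : 0 < F) (hpF : KimPadicL.pStar p ∣ F) (hfF : f ∣ F)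
    (t : ℂ_[p]) (ht : ‖(KimPadicL.pStar p : ℂ_[p]) * t‖ < 1) :
    (∀ a ∈ KimPadicL.units p F,
      (∀ s : ℂ_[p], ‖(F : ℂ_[p])‖ * ‖s - 1‖ < KimPadicL.expRadius p →
        Summable (KimPadicL.LTerm q F a s t)) ∧
      Summable (KimPadicL.oneTerm q F a t)) ∧
    Filter.Tendsto (fun s => KimPadicL.L q χ F s t) (nhdsWithin 1 {1}ᶜ)
      (nhds (KimPadicL.L q χ F 1 t)) ∧
    KimPadicL.L q χ F 1 t =
      1 / KimPadicL.qNum q (F : ℂ_[p]) *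
        ∑ a ∈ KimPadicL.units p F, χ (a : ZMod f) *
          (-(KimPadicL.qBernoulli (q ^ F) 0 * KimPadicL.plog (KimPadicL.angle q a t))
            + ∑' m : ℕ, KimPadicL.oneTerm q F a t m) := by
  rw [norm_sub_rev] at hq
  have hlim := KimPadicL.tendsto_LFormula hq hq1 ht hF.ne' hpF hfF hχ1
  have hL : KimPadicL.L q χ F 1 t = _ := (if_pos rfl).trans hlim.limUnder_eq
  refine ⟨fun a ha => ?_, ?_, hL⟩
  · have hap := KimPadicL.coprime_of_mem_units ha
    exact ⟨fun s hs => KimPadicL.summable_LTerm hq hq1 ht hF.ne' hpF hap hs,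
      KimPadicL.summable_oneTerm hq hq1 ht hF.ne' hpF hap⟩
  · rw [hL]
    refine hlim.congr' ?_
    filter_upwards [self_mem_nhdsWithin] with s hs
    exact (if_neg hs).symm

theorem theorem8 (p : ℕ) [Fact p.Prime] (q : ℂ_[p]) (hq1 : q ≠ 1)
    (hq : ‖1 - q‖ < (p : ℝ) ^ (-(1 / ((p : ℝ) - 1))))
    {f : ℕ} (χ : DirichletCharacter ℂ_[p] f) (hχ : χ.IsPrimitive) (hχ1 : χ ≠ 1)
    (F : ℕ) (hF : 0 < F) (hpF : KimPadicL.pStar p ∣ F) (hfF : f ∣ F)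
    (t : ℂ_[p]) (ht : ‖t‖ ≤ 1) :
    (∀ a ∈ KimPadicL.units p F,
      (∀ s : ℂ_[p], ‖s - 1‖ ≤ 1 → Summable (KimPadicL.LTerm q F a s t)) ∧
      Summable (KimPadicL.oneTerm q F a t)) ∧
    Filter.Tendsto (fun s => KimPadicL.L q χ F s t) (nhdsWithin 1 {1}ᶜ)
      (nhds (KimPadicL.L q χ F 1 t)) ∧
    KimPadicL.L q χ F 1 t =
      1 / KimPadicL.qNum q (F : ℂ_[p]) *
        ∑ a ∈ KimPadicL.units p F, χ (a : ZMod f) *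
          (-(KimPadicL.qBernoulli (q ^ F) 0 * KimPadicL.plog (KimPadicL.angle q a t))
            + ∑' m : ℕ, KimPadicL.oneTerm q F a t m) := by
  obtain ⟨hsummable, hlim⟩ := theorem8_general p q hq1 hq χ hχ1 F hF hpF hfF t
    (KimPadicL.norm_pStar_mul_lt_one ht)
  exact ⟨fun a ha => ⟨fun s hs => (hsummable a ha).1 s <|
    (mul_le_of_le_one_right (norm_nonneg _) hs).trans_lt (KimPadicL.norm_natCast_lt_expRadius hpF),
    (hsummable a ha).2⟩, hlim⟩
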